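/- Theorem 3.2 (NPRK$_M$ Order Conditions). Let $M\ge 1$, $s\ge 0$ and $p\ge 0$ be integers. An $s$-stage NPRK$_M$ method is given by real tensors $a=(a_{i_0i_1\dots i_M})$ of rank $M+1$ and $b=(b_{i_1\dots i_M})$ of rank $M$, with all indices in $\{1,\dots,s\}$. Let $f:X\to X$ be a vector field on a real Banach space $X$ and let $F:X^M\to X$ be an $M$-partition of $f$, i.e. $F(y,\dots,y)=f(y)$ for all $y\in X$. The step of size $h$ from $y_0$ is $$Y_{i_0}=y_0+h\sum_{i_1,\dots,i_M=1}^s a_{i_0i_1\dots i_M}F(Y_{i_1},\dots,Y_{i_M})\quad(i_0=1,\dots,s),\qquad y_1=y_0+h\sum_{i_1,\dots,i_M=1}^s b_{i_1\dots i_M}F(Y_{i_1},\dots,Y_{i_M}).$$ The method has order $p$ if for all such $X$, $f$ and $F$ with $F$ of class $C^\infty$, every $t_0\in\mathbb R$ and $y_0\in X$, every solution $y$ of $y'=f(y)$, $y(t_0)=y_0$ near $t_0$, and every solution $Y(h)=(Y_1(h),\dots,Y_s(h))$ of the stage equations for all $h$ near $0$ with $Y_i(h)\to y_0$ as $h\to0$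 for each $i$, one has $y_1(h)-y(t_0+h)=O(h^{p+1})$ as $h\to0$. An $M$-edge-colored rooted tree is a finite rooted tree whose edges are colored by $\{1,\dots,M\}$; write $\tau=[\tau_1|_{a_1},\dots,\tau_m|_{a_m}]$ if $\tau_1,\dots,\tau_m$ are the subtrees left after removing the root of $\tau$, joined to the root by edges of the colors $a_1,\dots,a_m$. Two trees are equivalent if they differ only in the ordering of the children of their vertices. Let $|\tau|$ be the number of vertices of $\tau$. Define the density by $\gamma(\tau)=|\tau|\,\gamma(\tau_1)\cdots\gamma(\tau_m)$, so that $\gamma=1$ for the one-vertex tree, the indexed elementary weight by $$\phi_{i_1\dots i_M}(\tau)=\prod_{k=1}^m\ \sum_{j_1,\dots,j_M=1}^s a_{i_{a_k}j_1\dots j_M}\,\phi_{j_1\dots j_M}(\tau_k),$$ so that $\phi=1$ for the one-vertex tree, and the elementary weight by $\Phi(\tau)=\sum_{i_1,\dots,i_M=1}^s b_{i_1\dots i_M}\phi_{i_1\dots i_M}(\tau)$. These depend only on the equivalence class of $\tau$. The method has order $p$ if and only if $$\Phi(\tau)=\frac1{\gamma(\tau)}$$ for every equivalence class $\tau$ of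 $M$-edge-colored rooted trees with $|\tau|\le p$. -/

import Mathlib

universe u

namespace NPRK

/-! ### Edge-colored rooted trees -/

/-- A rooted tree with an ordering of the children at each vertex, whose edges are colored by the
`M` colors `Fin M`. The term `node m c t` is the tree `[t 0|_{c 0}, …, t (m-1)|_{c (m-1)}]` : its
root has the `m` subtrees `t k`, and the edge from the root to `t k` has the color `c k`. -/
inductive OrderedTree (M : ℕ) : Type
  | node (m : ℕ) (c : Fin m → Fin M) (t : Fin m → OrderedTree M) : OrderedTree M

namespace OrderedTree

variable {M : ℕ}

/-- The number of vertices. -/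
def order : OrderedTree M → ℕ
  | node _ _ t => 1 + ∑ k, order (t k)

/-- The density: `γ(τ) = |τ| γ(τ₁) ⋯ γ(τₘ)`. -/
def density : OrderedTree M → ℕ
  | node m c t => order (node m c t) * ∏ k, density (t k)

/-- The indexed elementary weight `φ_{i₁ … i_M}(τ)`. An edge of color `c` from a vertex with
multi-index `i` up to a vertex with multi-index `j` contributes the factor `a_{i_c, j₁, …, j_M}`,
and all the multi-indices of the vertices other than the root are summed over. (The multi-indices
of different subtrees of the root are summed independently, so the sum factors.) -/
def indexedWeight {s : ℕ} (a : Fin s → (Fin M → Fin s) → ℝ) :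
    OrderedTree M → (Fin M → Fin s) → ℝ
  | node _ c t, i => ∏ k, ∑ j : Fin M → Fin s, a (i (c k)) j * indexedWeight a (t k) j

/-- Two trees are equivalent if they differ only by the ordering of the children of the vertices:
there is a bijection of the children of the roots that respects the colors of the edges and maps
every subtree to an equivalent one. -/
def Equivalent : OrderedTree M → OrderedTree M → Prop
  | node m c t, node m' c' t' =>
      ∃ e : Fin m ≃ Fin m', ∀ k, c k = c' (e k) ∧ Equivalent (t k) (t' (e k))

theorem Equivalent.refl (τ : OrderedTree M) : Equivalent τ τ := by
  induction τ with
  | node m c t ih => exact ⟨Equiv.refl _, fun k => ⟨rfl, ih k⟩⟩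

theorem Equivalent.symm {τ τ' : OrderedTree M} (h : Equivalent τ τ') : Equivalent τ' τ := by
  induction τ generalizing τ' with
  | node m c t ih =>
    cases τ' with
    | node m' c' t' =>
      obtain ⟨e, he⟩ := h
      refine ⟨e.symm, fun k => ?_⟩
      have h1 := he (e.symm k)
      rw [Equiv.apply_symm_apply] at h1
      exact ⟨h1.1.symm, ih _ h1.2⟩

theorem Equivalent.trans {τ τ' τ'' : OrderedTree M} (h : Equivalent τ τ')
    (h' : Equivalent τ' τ'') : Equivalent τ τ'' := by
  induction τ generalizing τ' τ'' with
  | node m c t ih =>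
    cases τ' with
    | node m' c' t' =>
      cases τ'' with
      | node m'' c'' t'' =>
        obtain ⟨e, he⟩ := h
        obtain ⟨e', he'⟩ := h'
        exact ⟨e.trans e', fun k =>
          ⟨(he k).1.trans (he' (e k)).1, ih k (he k).2 (he' (e k)).2⟩⟩

instance setoid (M : ℕ) : Setoid (OrderedTree M) where
  r := Equivalent
  iseqv := ⟨Equivalent.refl, Equivalent.symm, Equivalent.trans⟩

theorem Equivalent.order_eq {τ τ' : OrderedTree M} (h : Equivalent τ τ') :
    τ.order = τ'.order := by
  induction τ generalizing τ' with
  | node m c t ih =>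
    cases τ' with
    | node m' c' t' =>
      obtain ⟨e, he⟩ := h
      simp only [order]
      congr 1
      exact Fintype.sum_equiv e _ _ fun k => ih k (he k).2

theorem Equivalent.density_eq {τ τ' : OrderedTree M} (h : Equivalent τ τ') :
    τ.density = τ'.density := by
  induction τ generalizing τ' with
  | node m c t ih =>
    cases τ' with
    | node m' c' t' =>
      have h0 := h.order_eq
      obtain ⟨e, he⟩ := h
      simp only [density, h0]
      congr 1
      exact Fintype.prod_equiv e _ _ fun k => ih k (he k).2

theorem Equivalent.indexedWeight_eq {s : ℕ} (a : Fin s → (Fin M → Fin s) → ℝ)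
    {τ τ' : OrderedTree M} (h : Equivalent τ τ') :
    τ.indexedWeight a = τ'.indexedWeight a := by
  induction τ generalizing τ' with
  | node m c t ih =>
    cases τ' with
    | node m' c' t' =>
      obtain ⟨e, he⟩ := h
      funext i
      simp only [indexedWeight]
      refine Fintype.prod_equiv e _ _ fun k => ?_
      rw [(he k).1, ih k (he k).2]

end OrderedTree

/-- An `M`-edge-colored rooted tree: an equivalence class of ordered ones. -/
def Tree (M : ℕ) : Type := Quotient (OrderedTree.setoid M)

/-! ### NPRK methods -/

/-- The coefficients of an `s`-stage NPRK method with `M` partitions: the tensors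
`a_{i₀ i₁ … i_M}` and `b_{i₁ … i_M}`. -/
structure Method (M s : ℕ) where
  /-- The rank `M + 1` tensor, as a function of `i₀` and of `(i₁, …, i_M)`. -/
  a : Fin s → (Fin M → Fin s) → ℝ
  /-- The rank `M` tensor. -/
  b : (Fin M → Fin s) → ℝ

namespace Tree

variable {M : ℕ}

/-- The order `|τ|`, i.e. the number of vertices of `τ`. -/
def order (τ : Tree M) : ℕ :=
  Quotient.lift OrderedTree.order (fun _ _ h => OrderedTree.Equivalent.order_eq h) τ

/-- The density `γ(τ)`. -/
def density (τ : Tree M) : ℕ :=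
  Quotient.lift OrderedTree.density (fun _ _ h => OrderedTree.Equivalent.density_eq h) τ

/-- The indexed elementary weight `φ_{i₁ … i_M}(τ)`. -/
def indexedWeight {s : ℕ} (𝓜 : Method M s) (τ : Tree M) : (Fin M → Fin s) → ℝ :=
  Quotient.lift (OrderedTree.indexedWeight 𝓜.a)
    (fun _ _ h => OrderedTree.Equivalent.indexedWeight_eq 𝓜.a h) τ

/-- The elementary weight `Φ(τ) = ∑ b_{i₁ … i_M} φ_{i₁ … i_M}(τ)`. -/
def weight {s : ℕ} (𝓜 : Method M s) (τ : Tree M) : ℝ :=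
  ∑ i : Fin M → Fin s, 𝓜.b i * τ.indexedWeight 𝓜 i

end Tree

/-- `F` is an `M`-partition of the vector field `f`: `F(y, …, y) = f(y)`. -/
def IsPartition {M : ℕ} {X : Type*} (F : (Fin M → X) → X) (f : X → X) : Prop :=
  ∀ y : X, F (fun _ => y) = f y

namespace Method

variable {M s : ℕ} {X : Type*} [NormedAddCommGroup X] [NormedSpace ℝ X]

/-- `Y₁, …, Y_s` solve the stage equations
`Y_{i₀} = y₀ + h ∑ a_{i₀ i₁ … i_M} F(Y_{i₁}, …, Y_{i_M})` of the step of size `h` from `y₀`. -/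
def IsStages (𝓜 : Method M s) (F : (Fin M → X) → X) (h : ℝ) (y₀ : X) (Y : Fin s → X) : Prop :=
  ∀ i₀ : Fin s, Y i₀ = y₀ + h • ∑ i : Fin M → Fin s, 𝓜.a i₀ i • F (fun r => Y (i r))

/-- The result `y₁ = y₀ + h ∑ b_{i₁ … i_M} F(Y_{i₁}, …, Y_{i_M})` of the step of size `h` from `y₀`
with the stage values `Y`. -/
def step (𝓜 : Method M s) (F : (Fin M → X) → X) (h : ℝ) (y₀ : X) (Y : Fin s → X) : X :=
  y₀ + h • ∑ i : Fin M → Fin s, 𝓜.b i • F (fun r => Y (i r))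

/-- The method has order `p` if for every smooth `M`-partition `F` of a vector field `f` on a real
Banach space, every solution `y` of `y' = f(y)`, `y(t₀) = y₀` near `t₀`, and every solution
`Y = Y(h)` of the stage equations for small `h` with `Y(h) → (y₀, …, y₀)` as `h → 0`, the local
error `y₁(h) - y(t₀ + h)` is `O(h ^ (p + 1))` as `h → 0`. (By the implicit function theorem such
a `Y` exists, and any two of them agree for small `h`; for large stage values, which an implicit
method may have as well, nothing is claimed.) -/
def HasOrder {M s : ℕ} (𝓜 : Method M s) (p : ℕ) : Prop :=
  ∀ (X : Type u) [NormedAddCommGroup X] [NormedSpace ℝ X] [CompleteSpace X]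
    (f : X → X) (F : (Fin M → X) → X), IsPartition F f → ContDiff ℝ ((⊤ : ℕ∞) : WithTop ℕ∞) F →
  ∀ (t₀ : ℝ) (y₀ : X) (y : ℝ → X), y t₀ = y₀ →
    (∀ᶠ t in nhds t₀, HasDerivAt y (f (y t)) t) →
  ∀ Y : ℝ → Fin s → X, Filter.Tendsto Y (nhds 0) (nhds fun _ => y₀) →
    (∀ᶠ h in nhds (0 : ℝ), 𝓜.IsStages F h y₀ (Y h)) →
  (fun h : ℝ => 𝓜.step F h y₀ (Y h) - y (t₀ + h)) =O[nhds 0] fun h : ℝ => h ^ (p + 1)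

end Method

end NPRK

namespace NPRK

open Filter Topology Asymptotics

/-! ### Enumeration of ordered trees and multilinear expansion. -/

namespace OrderedTree

variable {M : ℕ}

/-! Both directions work with ordered trees; order, density and weight descend to classes, so this
proves the statement for `Tree`. The gain is that no symmetry factors occur: expanding `D^m F / m!`
multilinearly over `m`-tuples of (color, tree) yields each ordered tree with `m` branches exactly
once.

Sufficiency compares two B-series. If the arguments of `F` have expansions modulo `h ^ (n + 1)`, so
has the value of `F` (`isBigO_comp_sub_sum_upTo`), and multiplying by `h` or integrating gains one
power. Induction yields coefficient `Φ(τ)` for the step and `1 / γ(τ)` for the solution, with the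
same elementary differentials.

Necessity uses one polynomial field, `branchField`, with a coordinate for each tree of order at most
`p`. Its exact solution and stages from `0` are explicit monomials in each coordinate, and the local
error at `τ` is exactly `h ^ |τ| * (Φ(τ) - 1 / γ(τ))`. Since `|τ| ≤ p`, being `O(h ^ (p + 1))`
forces the bracket to vanish. -/

theorem order_pos (τ : OrderedTree M) : 0 < τ.order := by
  cases τ
  simp [order]

theorem order_lt (m : ℕ) (c : Fin m → Fin M) (t : Fin m → OrderedTree M) (k : Fin m) :
    (t k).order < (node m c t).order := by
  have := Finset.single_le_sum (f := fun k => (t k).order) (fun _ _ => Nat.zero_le _)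
    (Finset.mem_univ k)
  simp only [order]
  omega

/-- Joining a family of trees to a new root, along edges of the given colors. -/
def graft (M : ℕ) : (Σ m : ℕ, Fin m → Fin M × OrderedTree M) ↪ OrderedTree M where
  toFun x := node x.1 (fun k => (x.2 k).1) (fun k => (x.2 k).2)
  inj' := by
    rintro ⟨m, f⟩ ⟨m', f'⟩ h
    simp only [node.injEq] at h
    obtain ⟨rfl, h1, h2⟩ := h
    congr
    funext k
    exact Prod.ext (congrFun (eq_of_heq h1) k) (congrFun (eq_of_heq h2) k)

theorem graft_apply (x : Σ m : ℕ, Fin m → Fin M × OrderedTree M) :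
    graft M x = node x.1 (fun k => (x.2 k).1) (fun k => (x.2 k).2) :=
  rfl

/-- The trees with at most `n` vertices. -/
def upTo (M : ℕ) : ℕ → Finset (OrderedTree M)
  | 0 => ∅
  | n + 1 => (((Finset.range (n + 1)).sigma fun m =>
      Fintype.piFinset fun _ : Fin m => Finset.univ ×ˢ upTo M n).filter
        fun x => ∑ k, (x.2 k).2.order ≤ n).map (graft M)

theorem mem_upTo {n : ℕ} {τ : OrderedTree M} : τ ∈ upTo M n ↔ τ.order ≤ n := by
  induction n generalizing τ with
  | zero => simpa [upTo] using (order_pos τ).ne'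
  | succ n ih =>
    simp only [upTo, Finset.mem_map, Finset.mem_filter, Finset.mem_sigma, Finset.mem_range,
      Fintype.mem_piFinset, Finset.mem_product, Finset.mem_univ, true_and, ih]
    constructor
    · rintro ⟨⟨m, f⟩, ⟨-, h⟩, rfl⟩
      change ∑ k, (f k).2.order ≤ n at h
      simp only [graft_apply, order]
      omega
    · cases τ with
      | node m c t =>
        intro h
        have h' := h
        simp only [order] at h'
        refine ⟨⟨m, fun k => (c k, t k)⟩, ⟨⟨?_, fun k => ?_⟩, ?_⟩, rfl⟩
        · have : ∑ _k : Fin m, 1 ≤ ∑ k, (t k).order :=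
            Finset.sum_le_sum fun k _ => order_pos (t k)
          simp only [Finset.sum_const, Finset.card_univ, Fintype.card_fin, smul_eq_mul,
            mul_one] at this
          change m < n + 1
          omega
        · have := order_lt m c t k
          change (t k).order ≤ n
          omega
        · change ∑ k, (t k).order ≤ n
          omega

instance (n : ℕ) : Finite {τ : OrderedTree M // τ.order ≤ n} :=
  Finite.of_injective (β := upTo M n) (fun τ => ⟨τ.1, mem_upTo.2 τ.2⟩) fun _ _ h =>
    Subtype.ext (congrArg (fun x => x.1) h)

/-- The product of the weights of the branches at the root, the weight of a branch being allowed
to depend on the color of its edge. -/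
def branchProd (w : Fin M → OrderedTree M → ℝ) : OrderedTree M → ℝ
  | node _ c t => ∏ k, w (c k) (t k)

/-- The recursion for `γ` is what makes `h ^ |τ| / γ(τ)` solve the differential equation: the right
side is the coefficient of its derivative. -/
theorem branchProd_inv_density (τ : OrderedTree M) :
    branchProd (fun _ τ => 1 / (τ.density : ℝ)) τ = τ.order / τ.density := by
  cases τ with
  | node m c t =>
    have h1 : ((node m c t).order : ℝ) ≠ 0 := by exact_mod_cast (order_pos _).ne'
    simp only [branchProd, density, Nat.cast_mul, Nat.cast_prod]
    rw [div_mul_cancel_left₀ h1]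
    simp

theorem branchProd_indexedWeight {s : ℕ} (a : Fin s → (Fin M → Fin s) → ℝ) (i : Fin M → Fin s)
    (τ : OrderedTree M) :
    branchProd (fun r τ => ∑ j, a (i r) j * τ.indexedWeight a j) τ = τ.indexedWeight a i := by
  cases τ
  rfl

theorem pow_order_eq (h : ℝ) (τ : OrderedTree M) : h ^ τ.order = h * h ^ (τ.order - 1) := by
  rw [← pow_succ', Nat.sub_add_cancel (order_pos τ)]

variable {X : Type*} [NormedAddCommGroup X] [NormedSpace ℝ X]

/-- The elementary differential of a tree, built from a sequence of multilinear maps that stands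
for the Taylor coefficients of the vector field. -/
noncomputable def elementaryDifferential (A : FormalMultilinearSeries ℝ (Fin M → X) X) :
    OrderedTree M → X
  | node m c t => A m fun k => Pi.single (c k) (elementaryDifferential A (t k))

theorem map_sum_single (A : FormalMultilinearSeries ℝ (Fin M → X) X) (S : Finset (OrderedTree M))
    (w : Fin M → OrderedTree M → ℝ) (h : ℝ) (m : ℕ) :
    A m (fun _ r => ∑ τ ∈ S, (h ^ τ.order * w r τ) • τ.elementaryDifferential A) =
      ∑ f ∈ Fintype.piFinset fun _ : Fin m => Finset.univ ×ˢ S,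
        (h ^ ((graft M ⟨m, f⟩).order - 1) * branchProd w (graft M ⟨m, f⟩)) •
          (graft M ⟨m, f⟩).elementaryDifferential A := by
  -- Splitting the vector into its color components gives a single sum over (color, tree) pairs, to
  -- which multilinearity applies.
  have h1 : (fun r => ∑ τ ∈ S, (h ^ τ.order * w r τ) • τ.elementaryDifferential A) =
      ∑ x ∈ Finset.univ ×ˢ S, (h ^ x.2.order * w x.1 x.2) •
        (Pi.single x.1 (x.2.elementaryDifferential A) : Fin M → X) := by
    rw [Finset.sum_product]
    funext r
    simp only [Finset.sum_apply, Pi.smul_apply]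
    rw [Finset.sum_eq_single r]
    · simp
    · intro r' _ hr
      simp [Pi.single_eq_of_ne hr.symm]
    · simp
  rw [h1, (A m).map_sum_finset]
  refine Finset.sum_congr rfl fun f _ => ?_
  rw [(A m).map_smul_univ]
  simp only [graft_apply, order, branchProd, elementaryDifferential,
    Finset.prod_mul_distrib, Finset.prod_pow_eq_pow_sum, Nat.add_sub_cancel_left]

/-- Every tree in `upTo M (n + 1)` cancels; the finitely many grafted trees left over have at least
`n + 2` vertices. -/
theorem isBigO_sum_sub_sum_upTo (A : FormalMultilinearSeries ℝ (Fin M → X) X) (n : ℕ)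
    (w : Fin M → OrderedTree M → ℝ) :
    (fun h : ℝ => ∑ m ∈ Finset.range (n + 1), A m (fun _ r => ∑ τ ∈ upTo M n,
        (h ^ τ.order * w r τ) • τ.elementaryDifferential A) -
      ∑ τ ∈ upTo M (n + 1),
        (h ^ (τ.order - 1) * branchProd w τ) • τ.elementaryDifferential A)
      =O[𝓝 0] fun h => h ^ (n + 1) := by
  simp only [map_sum_single, upTo, Finset.sum_map]
  simp only [Finset.sum_sigma', Sigma.eta, Finset.sum_filter, ← Finset.sum_sub_distrib]
  refine IsBigO.fun_sum fun x _ => ?_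
  split_ifs with hx
  · simpa using isBigO_zero _ _
  · simp only [sub_zero]
    have h1 : (fun h : ℝ => h ^ ((graft M x).order - 1)) =O[𝓝 0] fun h => h ^ (n + 1) := by
      refine IsBigO.of_bound 1 ?_
      filter_upwards [Metric.ball_mem_nhds (0 : ℝ) one_pos] with h hh
      rw [mem_ball_zero_iff] at hh
      rw [norm_pow, norm_pow, one_mul]
      refine pow_le_pow_of_le_one (norm_nonneg _) hh.le ?_
      simp only [graft_apply, order]
      omega
    have h2 : (fun _ : ℝ => branchProd w (graft M x) • (graft M x).elementaryDifferential A)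
        =O[𝓝 0] fun _ => (1 : ℝ) := isBigO_const_const _ one_ne_zero _
    simpa [mul_smul] using h1.smul h2

end OrderedTree

open OrderedTree

/-! ### B-series expansions of the stages and of the exact solution. -/

section Expansion

variable {M : ℕ} {X : Type*} [NormedAddCommGroup X] [NormedSpace ℝ X]

/-- The Taylor coefficients `D^m F(x) / m!`. -/
noncomputable def taylorCoeff (F : (Fin M → X) → X) (x : Fin M → X) :
    FormalMultilinearSeries ℝ (Fin M → X) X :=
  fun m => (m.factorial : ℝ)⁻¹ • iteratedFDeriv ℝ m F x

/-- Taylor's formula with integral remainder; continuity bounds the derivative of order `n + 1` by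
`K` on a ball around `x`. -/
theorem isBigO_sub_taylorCoeff [CompleteSpace X] {F : (Fin M → X) → X}
    (hF : ContDiff ℝ ((⊤ : ℕ∞) : WithTop ℕ∞) F) (x : Fin M → X) (n : ℕ) :
    (fun v => F (x + v) - ∑ m ∈ Finset.range (n + 1), taylorCoeff F x m (fun _ => v))
      =O[𝓝 0] fun v => ‖v‖ ^ (n + 1) := by
  have hc : Continuous (iteratedFDeriv ℝ (n + 1) F) :=
    hF.continuous_iteratedFDeriv (by exact_mod_cast le_top)
  obtain ⟨ε, hε, hb⟩ := Metric.eventually_nhds_iff_ball.1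
    ((hc.norm.tendsto x).eventually (gt_mem_nhds (lt_add_one _)))
  set K := ‖iteratedFDeriv ℝ (n + 1) F x‖ + 1
  refine IsBigO.of_bound ((n.factorial : ℝ)⁻¹ * K) ?_
  filter_upwards [Metric.ball_mem_nhds (0 : Fin M → X) hε] with v hv
  rw [map_add_eq_sum_add_integral_iteratedFDeriv (n := n)
    fun t _ => hF.contDiffAt.of_le (by exact_mod_cast le_top)]
  simp only [taylorCoeff, _root_.smul_apply, add_sub_cancel_left]
  rw [norm_smul, norm_pow, norm_norm, mul_assoc, Real.norm_of_nonneg (by positivity)]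
  gcongr
  refine (intervalIntegral.norm_integral_le_of_norm_le_const (C := K * ‖v‖ ^ (n + 1))
    fun t ht => ?_).trans (by simp)
  rw [Set.uIoc_of_le zero_le_one] at ht
  have h1 : ‖iteratedFDeriv ℝ (n + 1) F (x + t • v)‖ ≤ K := by
    refine (hb _ ?_).le
    rw [Metric.mem_ball, dist_eq_norm, add_sub_cancel_left, norm_smul,
      Real.norm_of_nonneg ht.1.le]
    rw [mem_ball_zero_iff] at hv
    nlinarith [norm_nonneg v, ht.2]
  have h2 : ‖(1 - t) ^ n‖ ≤ 1 := by
    rw [norm_pow]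
    refine pow_le_one₀ (norm_nonneg _) ?_
    rw [Real.norm_of_nonneg (by linarith [ht.2])]
    linarith [ht.1]
  rw [norm_smul]
  refine (mul_le_of_le_one_left (norm_nonneg _) h2).trans ?_
  refine ((iteratedFDeriv ℝ (n + 1) F (x + t • v)).le_opNorm _).trans ?_
  simp only [Finset.prod_const, Finset.card_univ, Fintype.card_fin]
  gcongr

/-- If the arguments of `F` have a B-series expansion, then so has the value of `F`. -/
theorem isBigO_comp_sub_sum_upTo [CompleteSpace X] {F : (Fin M → X) → X}
    (hF : ContDiff ℝ ((⊤ : ℕ∞) : WithTop ℕ∞) F) (y₀ : X) (n : ℕ)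
    (w : Fin M → OrderedTree M → ℝ) (Z : ℝ → Fin M → X)
    (hZ : ∀ r, (fun h : ℝ => Z h r - y₀ - ∑ τ ∈ upTo M n, (h ^ τ.order * w r τ) •
      τ.elementaryDifferential (taylorCoeff F fun _ => y₀)) =O[𝓝 0] fun h => h ^ (n + 1)) :
    (fun h : ℝ => F (Z h) - ∑ τ ∈ upTo M (n + 1), (h ^ (τ.order - 1) * branchProd w τ) •
      τ.elementaryDifferential (taylorCoeff F fun _ => y₀)) =O[𝓝 0] fun h => h ^ (n + 1) := by
  set A := taylorCoeff F fun _ => y₀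
  set δ : ℝ → Fin M → X := fun h r => Z h r - y₀
  set P : ℝ → Fin M → X := fun h r =>
    ∑ τ ∈ upTo M n, (h ^ τ.order * w r τ) • τ.elementaryDifferential A with hP
  set g : (Fin M → X) → X := fun v => ∑ m ∈ Finset.range (n + 1), A m (fun _ => v)
  have hδP : (fun h => δ h - P h) =O[𝓝 0] fun h => h ^ (n + 1) := isBigO_pi.2 hZ
  have hpow : (fun h : ℝ => h ^ (n + 1)) =O[𝓝 0] fun h => h := by
    simpa [pow_succ'] using (isBigO_refl (fun h : ℝ => h) (𝓝 0)).mul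
      (((continuous_pow n).tendsto (0 : ℝ)).isBigO_one ℝ)
  have hPO : P =O[𝓝 0] fun h => h := by
    refine isBigO_pi.2 fun r => IsBigO.fun_sum fun τ _ => ?_
    simp only [pow_order_eq, mul_assoc, mul_smul]
    have : Continuous fun h : ℝ => h ^ (τ.order - 1) • w r τ • τ.elementaryDifferential A := by
      fun_prop
    simpa using (isBigO_refl (fun h : ℝ => h) (𝓝 0)).smul ((this.tendsto 0).isBigO_one ℝ)
  have hδO : δ =O[𝓝 0] fun h => h := by
    simpa using (hδP.trans hpow).add hPO
  have hP0 : Tendsto P (𝓝 0) (𝓝 0) := hPO.trans_tendsto tendsto_id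
  have hδ0 : Tendsto δ (𝓝 0) (𝓝 0) := hδO.trans_tendsto tendsto_id
  have h1 : (fun h => F (Z h) - g (δ h)) =O[𝓝 0] fun h => h ^ (n + 1) := by
    have h := ((isBigO_sub_taylorCoeff hF (fun _ => y₀) n).comp_tendsto hδ0).trans
      (hδO.norm_left.pow (n + 1))
    refine h.congr_left fun t => ?_
    simp only [Function.comp, g, A]
    congr 2
    funext r
    simp [δ]
  -- The Taylor polynomial is C¹, hence Lipschitz near `0`, so truncating its argument costs only
  -- `O(h ^ (n + 1))`.
  have h2 : (fun h => g (δ h) - g (P h)) =O[𝓝 0] fun h => h ^ (n + 1) := by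
    have hg : ContDiff ℝ 1 g := by
      refine ContDiff.sum fun m _ => (A m).contDiff.comp ?_
      fun_prop
    obtain ⟨K, s, hs, hK⟩ := (hg.contDiffAt (x := 0)).exists_lipschitzOnWith
    refine IsBigO.trans (IsBigO.of_bound K ?_) hδP
    filter_upwards [hδ0 hs, hP0 hs] with h h3 h4
    exact hK.norm_sub_le h3 h4
  refine ((h1.add h2).add (isBigO_sum_sub_sum_upTo A n w)).congr_left fun h => ?_
  simp only [g, hP]
  abel

theorem isBigO_smul_sum_sub_sum_upTo {ι : Type*} [Fintype ι] (n : ℕ) (D : OrderedTree M → X)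
    (φ : OrderedTree M → ι → ℝ) (G : ι → ℝ → X) (b : ι → ℝ)
    (hG : ∀ i, (fun h : ℝ => G i h - ∑ τ ∈ upTo M n, (h ^ (τ.order - 1) * φ τ i) • D τ)
      =O[𝓝 0] fun h => h ^ n) :
    (fun h : ℝ => h • ∑ i, b i • G i h -
      ∑ τ ∈ upTo M n, (h ^ τ.order * ∑ i, b i * φ τ i) • D τ) =O[𝓝 0] fun h => h ^ (n + 1) := by
  have h1 := (isBigO_refl (fun h : ℝ => h) (𝓝 0)).smul
    (IsBigO.fun_sum (s := Finset.univ) fun i _ => (hG i).const_smul_left (b i))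
  simp only [smul_eq_mul, ← pow_succ'] at h1
  refine h1.congr_left fun h => ?_
  simp only [Pi.smul_apply, smul_sub, Finset.sum_sub_distrib]
  congr 1
  simp only [Finset.smul_sum]
  rw [Finset.sum_comm]
  refine Finset.sum_congr rfl fun τ _ => ?_
  simp only [smul_smul, ← Finset.sum_smul, Finset.mul_sum, pow_order_eq]
  congr 1
  exact Finset.sum_congr rfl fun i _ => by ring

/-- Mean value inequality on the closed ball of radius `‖h‖`, which covers both signs of `h`. -/
theorem isBigO_of_hasDerivAt {E E' : ℝ → X} (h0 : E 0 = 0) (n : ℕ)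
    (hE : ∀ᶠ h in 𝓝 0, HasDerivAt E (E' h) h) (hE' : E' =O[𝓝 0] fun h => h ^ n) :
    E =O[𝓝 0] fun h => h ^ (n + 1) := by
  obtain ⟨C, hC0, hC⟩ := hE'.exists_nonneg
  rw [isBigOWith_iff] at hC
  obtain ⟨ε, hε, hb⟩ := Metric.eventually_nhds_iff_ball.1 (hE.and hC)
  refine IsBigO.of_bound C ?_
  filter_upwards [Metric.ball_mem_nhds (0 : ℝ) hε] with h hh
  have h1 := (convex_closedBall (0 : ℝ) ‖h‖).norm_image_sub_le_of_norm_hasDerivWithin_le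
    (f := E) (f' := E') (C := C * ‖h‖ ^ n) (x := 0) (y := h) (fun x hx => ?_) (fun x hx => ?_)
    (by simp) (by simp)
  · simpa [h0, pow_succ, mul_assoc] using h1
  · refine (hb x ?_).1.hasDerivWithinAt
    simp only [Metric.mem_closedBall, Metric.mem_ball, dist_zero_right] at *
    linarith
  · have hx' : ‖x‖ ≤ ‖h‖ := by simpa using hx
    have h2 := hb x (by
      simp only [Metric.mem_ball, dist_zero_right] at *
      linarith)
    refine h2.2.trans ?_
    rw [norm_pow]
    gcongr

theorem isBigO_stages_sub_sum_upTo [CompleteSpace X] {s : ℕ} (𝓜 : Method M s)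
    {F : (Fin M → X) → X} (hF : ContDiff ℝ ((⊤ : ℕ∞) : WithTop ℕ∞) F) {y₀ : X}
    {Y : ℝ → Fin s → X} (hY : Tendsto Y (𝓝 0) (𝓝 fun _ => y₀))
    (hstages : ∀ᶠ h in 𝓝 (0 : ℝ), 𝓜.IsStages F h y₀ (Y h)) (n : ℕ) (i : Fin M → Fin s) :
    (fun h : ℝ => F (fun r => Y h (i r)) -
      ∑ τ ∈ upTo M n, (h ^ (τ.order - 1) * τ.indexedWeight 𝓜.a i) •
        τ.elementaryDifferential (taylorCoeff F fun _ => y₀)) =O[𝓝 0] fun h => h ^ n := by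
  induction n generalizing i with
  -- The base case needs only boundedness, which is where the convergence of the stages to `y₀`
  -- enters.
  | zero =>
    simp only [upTo, Finset.sum_empty, sub_zero, pow_zero]
    have h1 : Tendsto (fun h r => Y h (i r)) (𝓝 0) (𝓝 fun _ => y₀) :=
      tendsto_pi_nhds.2 fun r => tendsto_pi_nhds.1 hY (i r)
    exact ((hF.continuous.tendsto _).comp h1).isBigO_one ℝ
  | succ n ih =>
    have h1 := isBigO_comp_sub_sum_upTo hF y₀ n
      (fun r τ => ∑ j, 𝓜.a (i r) j * τ.indexedWeight 𝓜.a j) (fun h r => Y h (i r)) fun r => by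
        refine (isBigO_smul_sum_sub_sum_upTo n _ _ _ (𝓜.a (i r)) ih).congr' ?_ EventuallyEq.rfl
        filter_upwards [hstages] with h hh
        rw [eq_sub_of_add_eq' (hh (i r)).symm]
    simpa only [branchProd_indexedWeight] using h1

theorem isBigO_solution_sub_sum_upTo [CompleteSpace X] {f : X → X} {F : (Fin M → X) → X}
    (hf : IsPartition F f) (hF : ContDiff ℝ ((⊤ : ℕ∞) : WithTop ℕ∞) F) {t₀ : ℝ} {y₀ : X}
    {y : ℝ → X} (hy₀ : y t₀ = y₀) (hy : ∀ᶠ t in 𝓝 t₀, HasDerivAt y (f (y t)) t) (n : ℕ) :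
    (fun h : ℝ => y (t₀ + h) - y₀ - ∑ τ ∈ upTo M n, (h ^ τ.order * (1 / (τ.density : ℝ))) •
        τ.elementaryDifferential (taylorCoeff F fun _ => y₀)) =O[𝓝 0] fun h => h ^ (n + 1) := by
  have ht : Tendsto (fun h => t₀ + h) (𝓝 0) (𝓝 t₀) := by
    simpa using (continuous_const_add t₀).tendsto 0
  have hz : ∀ᶠ h in 𝓝 0, HasDerivAt (fun h => y (t₀ + h)) (F fun _ => y (t₀ + h)) h := by
    filter_upwards [ht.eventually hy] with h hh
    rw [hf]
    exact hh.comp_const_add t₀ h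
  -- Integration step: an expansion of the derivative `F (y, …, y)` gives one of `y`, one power
  -- higher.
  have key : ∀ n, (fun h : ℝ => (F fun _ => y (t₀ + h)) -
      ∑ τ ∈ upTo M n, (h ^ (τ.order - 1) * (τ.order / τ.density : ℝ)) •
        τ.elementaryDifferential (taylorCoeff F fun _ => y₀)) =O[𝓝 0] (fun h => h ^ n) →
      (fun h : ℝ => y (t₀ + h) - y₀ - ∑ τ ∈ upTo M n, (h ^ τ.order * (1 / (τ.density : ℝ))) •
        τ.elementaryDifferential (taylorCoeff F fun _ => y₀)) =O[𝓝 0] fun h => h ^ (n + 1) := by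
    intro n h1
    refine isBigO_of_hasDerivAt ?_ n ?_ h1
    · rw [Finset.sum_eq_zero fun τ _ => by simp [(order_pos τ).ne'], add_zero, hy₀]
      simp
    · filter_upwards [hz] with h hh
      refine (hh.sub_const y₀).fun_sub (HasDerivAt.fun_sum fun τ _ => ?_)
      have h2 := ((hasDerivAt_pow τ.order h).mul_const (1 / (τ.density : ℝ))).smul_const
        (τ.elementaryDifferential (taylorCoeff F fun _ => y₀))
      convert h2 using 2
      ring
  refine key n ?_
  induction n with
  | zero =>
    simp only [upTo, Finset.sum_empty, sub_zero, pow_zero]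
    have h1 : Tendsto (fun h (_ : Fin M) => y (t₀ + h)) (𝓝 0) (𝓝 fun _ => y t₀) :=
      tendsto_pi_nhds.2 fun _ => hy.self_of_nhds.continuousAt.tendsto.comp ht
    exact ((hF.continuous.tendsto _).comp h1).isBigO_one ℝ
  | succ n ih =>
    simpa only [branchProd_inv_density] using isBigO_comp_sub_sum_upTo hF y₀ n
      (fun _ τ => 1 / (τ.density : ℝ)) (fun h _ => y (t₀ + h)) fun _ => key n ih

end Expansion

theorem Method.hasOrder_of_weight_eq {M s : ℕ} (𝓜 : Method M s) (p : ℕ)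
    (H : ∀ τ : OrderedTree M, τ.order ≤ p →
      ∑ i, 𝓜.b i * τ.indexedWeight 𝓜.a i = 1 / (τ.density : ℝ)) :
    HasOrder.{u} 𝓜 p := by
  intro X _ _ _ f F hf hF t₀ y₀ y hy₀ hy Y hY hstages
  have h1 := isBigO_smul_sum_sub_sum_upTo p _ _ _ 𝓜.b
    (isBigO_stages_sub_sum_upTo 𝓜 hF hY hstages p)
  have h2 := isBigO_solution_sub_sum_upTo hf hF hy₀ hy p
  refine (h1.sub h2).congr_left fun h => ?_
  have h3 := Finset.sum_congr (rfl : upTo M p = upTo M p) fun τ hτ =>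
    congrArg (fun x => (h ^ τ.order * x) • τ.elementaryDifferential (taylorCoeff F fun _ => y₀))
      (H τ (mem_upTo.1 hτ))
  simp only [step, h3]
  abel

/-! ### The vector field that detects a single tree -/

namespace OrderedTree

variable {M : ℕ}

/-- The orders of the branches add up to `|σ| - 1`. Only trees smaller than `σ` matter, so the
cutoff in `coord` is harmless. -/
theorem branchProd_eq_pow_mul {v w : Fin M → OrderedTree M → ℝ} {t : ℝ} {σ : OrderedTree M}
    (h : ∀ r τ, τ.order < σ.order → v r τ = t ^ τ.order * w r τ) :
    branchProd v σ = t ^ (σ.order - 1) * branchProd w σ := by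
  cases σ with
  | node m c u =>
    simp only [branchProd, h _ _ (order_lt m c u _), Finset.prod_mul_distrib,
      Finset.prod_pow_eq_pow_sum, order, Nat.add_sub_cancel_left]

/-- The space with one coordinate for each tree with at most `p` vertices. -/
abbrev Coords (M p : ℕ) : Type u :=
  ULift.{u} {τ : OrderedTree M // τ.order ≤ p} → ℝ

noncomputable instance (p : ℕ) : Fintype (ULift.{u} {τ : OrderedTree M // τ.order ≤ p}) :=
  Fintype.ofFinite _

/-- The coordinate of a tree, which is zero for the trees with more than `p` vertices. -/
noncomputable def coord {p : ℕ} (x : Coords.{u} M p) (τ : OrderedTree M) : ℝ :=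
  if h : τ.order ≤ p then x ⟨⟨τ, h⟩⟩ else 0

/-- The partitioned vector field whose component at a tree is the product of the coordinates
of the branches of the tree, each taken of the argument given by the color of its edge. -/
noncomputable def branchField (M p : ℕ) (Y : Fin M → Coords.{u} M p) : Coords.{u} M p :=
  fun σ => branchProd (fun r τ => coord (Y r) τ) σ.down.1

theorem contDiff_branchField (M p : ℕ) (n : WithTop ℕ∞) :
    ContDiff ℝ n (branchField.{u} M p) := by
  refine contDiff_pi.2 fun σ => ?_
  obtain ⟨⟨⟨m, c, t⟩, hσ⟩⟩ := σ
  simp only [branchField, branchProd]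
  refine contDiff_prod fun k _ => ?_
  simp only [coord]
  split_ifs
  · fun_prop
  · exact contDiff_const

theorem branchField_apply {p : ℕ} {Y : Fin M → Coords.{u} M p} {w : Fin M → OrderedTree M → ℝ}
    {t : ℝ} (h : ∀ r σ, Y r σ = t ^ σ.down.1.order * w r σ.down.1)
    (σ : ULift.{u} {τ : OrderedTree M // τ.order ≤ p}) :
    branchField M p Y σ = t ^ (σ.down.1.order - 1) * branchProd w σ.down.1 := by
  refine branchProd_eq_pow_mul fun r τ hτ => ?_
  rw [coord, dif_pos (hτ.le.trans σ.down.2), h]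

end OrderedTree

theorem eq_zero_of_pow_mul_isBigO {c : ℝ} {q p : ℕ} (hqp : q ≤ p)
    (h : (fun t : ℝ => t ^ q * c) =O[𝓝 0] fun t => t ^ (p + 1)) : c = 0 := by
  by_contra hc
  have h1 := h.trans_isLittleO (isLittleO_pow_pow (𝕜 := ℝ) (Nat.lt_succ_of_le hqp))
  simp only [mul_comm _ c] at h1
  rw [isLittleO_const_mul_left_iff hc] at h1
  refine isLittleO_irrefl ?_ h1
  have h2 : ∃ᶠ t in 𝓝[≠] (0 : ℝ), t ∈ ({0}ᶜ : Set ℝ) := eventually_mem_nhdsWithin.frequently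
  exact (h2.filter_mono nhdsWithin_le_nhds).mono fun t ht => pow_ne_zero q ht

theorem Method.weight_eq_of_hasOrder {M s : ℕ} (𝓜 : Method M s) (p : ℕ)
    (H : HasOrder.{u} 𝓜 p) (τ : OrderedTree M) (hτ : τ.order ≤ p) :
    ∑ i, 𝓜.b i * τ.indexedWeight 𝓜.a i = 1 / (τ.density : ℝ) := by
  set y : ℝ → Coords.{u} M p := fun t σ => t ^ σ.down.1.order * (1 / (σ.down.1.density : ℝ))
    with hy
  -- These are exact stages for every `h`: by homogeneity the field at `σ` is `h ^ (|σ| - 1)` times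
  -- the indexed weight.
  set Y : ℝ → Fin s → Coords.{u} M p := fun h i₀ σ =>
    h ^ σ.down.1.order * ∑ j, 𝓜.a i₀ j * σ.down.1.indexedWeight 𝓜.a j with hY
  have hFY : ∀ h i σ, branchField M p (fun r => Y h (i r)) σ =
      h ^ (σ.down.1.order - 1) * σ.down.1.indexedWeight 𝓜.a i := by
    intro h i σ
    rw [branchField_apply (w := fun r τ => ∑ j, 𝓜.a (i r) j * τ.indexedWeight 𝓜.a j)
      (fun _ _ => rfl), branchProd_indexedWeight]
  have hsum : ∀ (h : ℝ) (b : (Fin M → Fin s) → ℝ) σ,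
      (h • ∑ i, b i • branchField M p (fun r => Y h (i r))) σ =
        h ^ σ.down.1.order * ∑ i, b i * σ.down.1.indexedWeight 𝓜.a i := by
    intro h b σ
    simp only [Pi.smul_apply, Finset.sum_apply, hFY, smul_eq_mul, Finset.mul_sum, pow_order_eq]
    exact Finset.sum_congr rfl fun i _ => by ring
  have h1 := H (Coords.{u} M p) (fun x => branchField M p fun _ => x) (branchField M p)
    (fun _ => rfl) (contDiff_branchField M p _) 0 0 y
    (by
      funext σ
      simp [hy, (order_pos _).ne'])
    (Eventually.of_forall fun t => by
      refine hasDerivAt_pi.2 fun σ => ?_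
      rw [branchField_apply (w := fun _ τ => 1 / (τ.density : ℝ)) (fun _ _ => rfl),
        branchProd_inv_density]
      refine ((hasDerivAt_pow σ.down.1.order t).mul_const
        (1 / (σ.down.1.density : ℝ))).congr_deriv ?_
      ring)
    Y
    (by
      have hc : Continuous Y := by fun_prop
      convert hc.tendsto 0 using 2
      funext i₀ σ
      simp [hY, (order_pos _).ne'])
    (Eventually.of_forall fun h i₀ => by
      funext σ
      rw [zero_add, hsum])
  have h2 := isBigO_pi.1 h1 ⟨⟨τ, hτ⟩⟩
  refine sub_eq_zero.1 (eq_zero_of_pow_mul_isBigO hτ (h2.congr_left fun h => ?_))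
  simp only [step, zero_add, Pi.sub_apply, hsum, hy]
  ring

end NPRK

theorem theorem3p2 {M s : ℕ} (hM : 0 < M) (𝓜 : NPRK.Method M s) (p : ℕ) :
    NPRK.Method.HasOrder.{u} 𝓜 p ↔
      ∀ τ : NPRK.Tree M, τ.order ≤ p → τ.weight 𝓜 = 1 / (τ.density : ℝ) := by
  refine ⟨fun H τ => ?_, fun H => 𝓜.hasOrder_of_weight_eq p fun τ hτ => H (Quotient.mk _ τ) hτ⟩
  induction τ using Quotient.ind with
  | _ τ => exact 𝓜.weight_eq_of_hasOrder p H τ
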